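/- **Theorem (SSA-MPC).** Consider a linear system $x_{i+1}=Ax_i+Bu_i$, $y_i=Gx_i$ with Cartesian position $Cx_i\in\mathbb R^3$, convex constraint sets $\mathcal D^x,\mathcal D^u$, convex stage costs $L_i\ge 0$, a reference output $y^{\rm ref}_i$, a horizon $N^h\ge 1$, an initial state $x_{init}$, obstacles $k=1,\dots,N^{obs}$ with radii $r_k>0$ and estimates $\hat r_k\ge r_k$, a safety radius $r_p\ge0$ of the agent, $\bar r_k=\hat r_k+r_p$, and a risk tolerance $\epsilon\in(0,1]$. For random predicted obstacle centres $Y=(Y_{i,k})$ with joint law $\mathbb P$ let $\mathcal O^{pred}_i=\bigcup_k\{p\in\mathbb R^3:\|p-Y_{i,k}\|<\bar r_k\}$. The *planning problem* for $\mathbb P$ is to minimize $\sum_{i=1}^{N^h} L_i(y_i^{\rm ref}-Gx_i,u_i)$ subject to the dynamics, $x_1=x_{init}$, $x_i\in\mathcal D^x$, $u_i\in\mathcal D^u$, and $\mathbb P(Cx_i\in\mathcal O^{pred}_i)\le\epsilon$ for $i=1,\dots,N^h$. Let $\hat y^j_{i,k}\in\mathbb R^3$, $j=1,\dots,N^{strap}$,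 be any forecasts of the obstacle centres (in particular bootstrapped SSA forecasts). For a trajectory $\bar x$ and a centre $y$ put $$\alpha_{i,k}(y)=-(C\bar x_i-y),\qquad \beta_{i,k}(y)=\bar r_k\|C\bar x_i-y\|+y^T(C\bar x_i-y),$$ so that $z_{i,k}(y)=\alpha_{i,k}(y)^TCx_i+\beta_{i,k}(y)\le 0$ is the linearized collision constraint $(Cx_i-y)^T(C\bar x_i-y)\ge\bar r_k\|C\bar x_i-y\|$. Let $\mathbb E[\alpha_{i,k}],\mathbb E[\beta_{i,k}],\Sigma_\alpha,\Sigma_{\alpha\beta},\Sigma_\beta$ be the sample means and (co)variances of $\alpha_{i,k}(\hat y^j_{i,k})$ and $\beta_{i,k}(\hat y^j_{i,k})$ over $j$ (the covariances with divisor $N^{strap}$ or $N^{strap}-1$, whichever convention is used, the divisor being positive), let $\tilde\Sigma=\Sigma_\alpha+\Pi$ with $\Pi$ the orthogonal projection onto $\ker\Sigma_\alpha$, $h_{i,k}=-\tilde\Sigma^{-1}\Sigma_{\alpha\beta}$, $k_{i,k}=\Sigma_\beta-\Sigma_{\alpha\beta}^T\tilde\Sigma^{-1}\Sigma_{\alpha\beta}$,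 $\epsilon_n=\epsilon/N^{obs}$, $\nu=\sqrt{(1-\epsilon_n)/\epsilon_n}$. Given $\chi\ge0$ and $\tau\in(0,1)$, the program of iteration $w\ge 1$ is to minimize $\sum_i L_i(y_i^{\rm ref}-Gx_i,u_i)$ over $x_i,u_i$ and $s_{i,k}\in\mathbb R^3$, subject to the dynamics, $x_1=x_{init}$, $x_i\in\mathcal D^x$, $u_i\in\mathcal D^u$, the affine collision constraints $$\begin{bmatrix}\mathbb E[\alpha_{i,k}]^TC&\nu\mathbf 1^T\\ \tilde\Sigma^{1/2}C&-I\\-\tilde\Sigma^{1/2}C&-I\end{bmatrix}\begin{bmatrix}x_i\\s_{i,k}\end{bmatrix}\le\begin{bmatrix}-\mathbb E[\beta_{i,k}]-\nu\sqrt{3k_{i,k}}\\\tilde\Sigma^{1/2}h_{i,k}\\-\tilde\Sigma^{1/2}h_{i,k}\end{bmatrix}$$ and the trust region $\|x_i-\bar x_i\|\le\chi\tau^w$, for all $i$ and $k$, where $\bar x=x^{(w-1)}$ is the solution of iteration $w-1$ and $x^{(0)}$ is an initial guess with $Cx^{(0)}_i\ne\hat y^j_{i,k}$ for all $i,j,k$.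 Let $(x^{(w)},u^{(w)},s^{(w)})$ be a solution of the program of iteration $w$, for every $w\ge1$. Call a law $\mathbb P$ of $Y$ *compatible* if almost surely $Y_{i,k}\ne Cx^{(0)}_i$ for all $i,k$, and if for all $w\ge 1$, $i$, $k$ the random variable $z_{i,k}(Y_{i,k})$ formed with $\bar x=x^{(w-1)}$ and $x=x^{(w)}$ is square integrable, its mean is the sample mean of $z_{i,k}(\hat y^j_{i,k})$, and its variance is at most the sample variance of $z_{i,k}(\hat y^j_{i,k})$. Then: 1. Every one of the programs is convex (convex feasible set, convex cost). 2. The bootstrap distribution, which gives each forecast $\hat y^j$ the probability $1/N^{strap}$, is compatible. 3. The trajectories $x^{(w)}$ converge to some $x^{(\infty)}$ as $w\to\infty$; if $\mathcal D^u$ is compact, the inputs $u^{(w)}$ have an accumulation point. 4. For every compatible law $\mathbb P$: $(x^{(w)},u^{(w)})$ is feasible for the planning problem for every $w\ge1$; and if $\mathcal D^x$ and $\mathcal D^u$ are closed, then $(x^{(\infty)},u^{(\infty)})$ is feasible for the planning problem for every accumulation point $u^{(\infty)}$ of $u^{(w)}$. -/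

import Mathlib

open MeasureTheory ProbabilityTheory Filter Topology

noncomputable section

namespace SSAMPC

/-- Column vectors of length `n`, with the Euclidean norm. -/
abbrev Vec (n : ℕ) : Type := EuclideanSpace ℝ (Fin n)

/-- A family of centre positions, one for every time of the horizon and every obstacle. -/
abbrev Centers (Nh Nobs : ℕ) : Type := Fin Nh → Fin Nobs → Vec 3

/-- The data of the planning problem: a linear system `x⁺ = A x + B u` with output `y = G x` and
Cartesian position `C x`, convex state and input constraints, convex nonnegative stage costs, a
reference output, the initial state, the radii of the obstacles with their (over-)estimates, the
safety radius of the agent, and the risk tolerance. -/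
structure PlanningProblem (nx nu ny Nh Nobs : ℕ) where
  A : Matrix (Fin nx) (Fin nx) ℝ
  B : Matrix (Fin nx) (Fin nu) ℝ
  G : Matrix (Fin ny) (Fin nx) ℝ
  C : Matrix (Fin 3) (Fin nx) ℝ
  Dx : Set (Vec nx)
  Du : Set (Vec nu)
  convex_Dx : Convex ℝ Dx
  convex_Du : Convex ℝ Du
  cost : Fin Nh → Vec ny × Vec nu → ℝ
  cost_nonneg : ∀ i p, 0 ≤ cost i p
  convexOn_cost : ∀ i, ConvexOn ℝ Set.univ (cost i)
  yref : Fin Nh → Vec ny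
  xinit : Vec nx
  radius : Fin Nobs → ℝ
  radius_pos : ∀ k, 0 < radius k
  radiusEst : Fin Nobs → ℝ
  radius_le_radiusEst : ∀ k, radius k ≤ radiusEst k
  safetyRadius : ℝ
  safetyRadius_nonneg : 0 ≤ safetyRadius
  ε : ℝ
  ε_pos : 0 < ε
  ε_le_one : ε ≤ 1

namespace PlanningProblem

variable {nx nu ny Nh Nobs : ℕ} (Q : PlanningProblem nx nu ny Nh Nobs)

/-- The Cartesian position `C x` of the agent in the state `x`. -/
def pos (x : Vec nx) : Vec 3 := Matrix.toEuclideanLin Q.C x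

/-- The collision radius: estimated obstacle radius plus safety radius of the agent. -/
def rbar (k : Fin Nobs) : ℝ := Q.radiusEst k + Q.safetyRadius

/-- The total cost of a trajectory `x` with inputs `u`. -/
def totalCost (x : Fin Nh → Vec nx) (u : Fin Nh → Vec nu) : ℝ :=
  ∑ i, Q.cost i (Q.yref i - Matrix.toEuclideanLin Q.G (x i), u i)

/-- The dynamics, the initial condition, and the state and input constraints. -/
structure Admissible [NeZero Nh] (x : Fin Nh → Vec nx) (u : Fin Nh → Vec nu) : Prop where
  dynamics : ∀ i j : Fin Nh, (j : ℕ) = (i : ℕ) + 1 →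
    x j = Matrix.toEuclideanLin Q.A (x i) + Matrix.toEuclideanLin Q.B (u i)
  init : x 0 = Q.xinit
  state_mem : ∀ i, x i ∈ Q.Dx
  input_mem : ∀ i, u i ∈ Q.Du

/-- The set of unsafe positions at time `i` if the obstacles have the centres `Y`: the positions
that are closer than the collision radius to the centre of some obstacle. -/
def unsafeSet (Y : Centers Nh Nobs) (i : Fin Nh) : Set (Vec 3) :=
  ⋃ k, Metric.ball (Y i k) (Q.rbar k)

/-- Feasible points of the chance-constrained planning problem, where `P` is the (joint) law of the
random predicted obstacle centres. -/
structure Feasible [NeZero Nh] (P : Measure (Centers Nh Nobs))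
    (x : Fin Nh → Vec nx) (u : Fin Nh → Vec nu) : Prop where
  admissible : Q.Admissible x u
  chance : ∀ i, P {Y | Q.pos (x i) ∈ Q.unsafeSet Y i} ≤ ENNReal.ofReal Q.ε

/-! ### The linearized collision constraint and its sample moments -/

/-- The coefficient `α = -(C x̄ - y)` of the collision constraint linearized at `x̄`, for an
obstacle centre `y`. -/
def alpha (xbar : Vec nx) (y : Vec 3) : Vec 3 := -(Q.pos xbar - y)

/-- The offset `β = r̄ ‖C x̄ - y‖ + yᵀ (C x̄ - y)`. -/
def beta (k : Fin Nobs) (xbar : Vec nx) (y : Vec 3) : ℝ :=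
  Q.rbar k * ‖Q.pos xbar - y‖ + inner ℝ y (Q.pos xbar - y)

/-- The linearized constraint function `z = αᵀ C x + β`; the constraint
`(C x - y)ᵀ (C x̄ - y) ≥ r̄ ‖C x̄ - y‖` says that `z ≤ 0`. -/
def zfun (k : Fin Nobs) (xbar x : Vec nx) (y : Vec 3) : ℝ :=
  inner ℝ (Q.alpha xbar y) (Q.pos x) + Q.beta k xbar y

end PlanningProblem

/-- Sample mean. -/
def sampleMean {N : ℕ} (a : Fin N → ℝ) : ℝ := (∑ j, a j) / N

/-- Sample covariance with divisor `d` (to be `N` or `N - 1`). -/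
def sampleCov {N : ℕ} (d : ℕ) (a b : Fin N → ℝ) : ℝ :=
  (∑ j, (a j - sampleMean a) * (b j - sampleMean b)) / d

/-- The orthogonal projection onto the null space of a symmetric matrix `M = U diag(λ) Uᵀ`, that is
`U diag(𝟙[λ = 0]) Uᵀ`. -/
def nullProj (M : Matrix (Fin 3) (Fin 3) ℝ) : Matrix (Fin 3) (Fin 3) ℝ :=
  cfc (fun t : ℝ => if t = 0 then 1 else 0) M

/-- `M` with the eigenvalue `0` replaced by `1`. -/
def regularized (M : Matrix (Fin 3) (Fin 3) ℝ) : Matrix (Fin 3) (Fin 3) ℝ := M + nullProj M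

/-- The symmetric positive semidefinite square root. -/
def matSqrt (M : Matrix (Fin 3) (Fin 3) ℝ) : Matrix (Fin 3) (Fin 3) ℝ := cfc Real.sqrt M

/-- The bootstrap distribution: each of the `N` forecasts has probability `1 / N`. -/
def bootstrapLaw {N Nh Nobs : ℕ} (yhat : Fin N → Centers Nh Nobs) :
    Measure (Centers Nh Nobs) :=
  (N : ENNReal)⁻¹ • ∑ j, Measure.dirac (yhat j)

namespace PlanningProblem

variable {nx nu ny Nh Nobs N : ℕ} (Q : PlanningProblem nx nu ny Nh Nobs)
  (d : ℕ) (yhat : Fin N → Centers Nh Nobs) (xbar : Fin Nh → Vec nx) (i : Fin Nh) (k : Fin Nobs)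

/-- Sample mean of `α`. -/
def meanAlpha : Fin 3 → ℝ := fun a => sampleMean fun j => Q.alpha (xbar i) (yhat j i k) a

/-- Sample mean of `β`. -/
def meanBeta : ℝ := sampleMean fun j => Q.beta k (xbar i) (yhat j i k)

/-- Sample covariance matrix of `α`. -/
def covAlpha : Matrix (Fin 3) (Fin 3) ℝ := Matrix.of fun a b =>
  sampleCov d (fun j => Q.alpha (xbar i) (yhat j i k) a) fun j => Q.alpha (xbar i) (yhat j i k) b

/-- Sample cross-covariance of `α` and `β`. -/
def covAlphaBeta : Fin 3 → ℝ := fun a =>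
  sampleCov d (fun j => Q.alpha (xbar i) (yhat j i k) a) fun j => Q.beta k (xbar i) (yhat j i k)

/-- Sample variance of `β`. -/
def varBeta : ℝ :=
  sampleCov d (fun j => Q.beta k (xbar i) (yhat j i k)) fun j => Q.beta k (xbar i) (yhat j i k)

/-- `Σ̃_α`. -/
def covReg : Matrix (Fin 3) (Fin 3) ℝ := regularized (Q.covAlpha d yhat xbar i k)

/-- `h = - Σ̃_α⁻¹ Σ_αβ`. -/
def hvec : Fin 3 → ℝ :=
  -((Q.covReg d yhat xbar i k)⁻¹.mulVec (Q.covAlphaBeta d yhat xbar i k))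

/-- `κ = Σ_β - Σ_αβᵀ Σ̃_α⁻¹ Σ_αβ`. -/
def kres : ℝ :=
  Q.varBeta d yhat xbar i k - dotProduct (Q.covAlphaBeta d yhat xbar i k)
    ((Q.covReg d yhat xbar i k)⁻¹.mulVec (Q.covAlphaBeta d yhat xbar i k))

/-- The risk `ε / N_obs` allotted to one obstacle. -/
def εn : ℝ := Q.ε / Nobs

/-- The factor `sqrt ((1 - ε_n) / ε_n)`. -/
def ν : ℝ := Real.sqrt ((1 - Q.εn) / Q.εn)

/-- The matrix `Λ` of the affine collision constraint, with `1 + 3 + 3` rows and `nx + 3` columns: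
`[E[α]ᵀ C, ν 𝟏ᵀ; Σ̃^{1/2} C, -I; -Σ̃^{1/2} C, -I]`. -/
def Lam : Matrix (Fin 1 ⊕ (Fin 3 ⊕ Fin 3)) (Fin nx ⊕ Fin 3) ℝ :=
  Matrix.fromRows
    (Matrix.fromCols
      (Matrix.of fun _ => Matrix.vecMul (Q.meanAlpha yhat xbar i k) Q.C)
      (Matrix.of fun _ _ => Q.ν))
    (Matrix.fromRows
      (Matrix.fromCols (matSqrt (Q.covReg d yhat xbar i k) * Q.C) (-1))
      (Matrix.fromCols (-(matSqrt (Q.covReg d yhat xbar i k) * Q.C)) (-1)))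

/-- The right-hand side
`Γ = [-E[β] - ν sqrt (3 κ); Σ̃^{1/2} h; -Σ̃^{1/2} h]`. -/
def Gam : Fin 1 ⊕ (Fin 3 ⊕ Fin 3) → ℝ :=
  Sum.elim
    (fun _ => -Q.meanBeta yhat xbar i k - Q.ν * Real.sqrt (3 * Q.kres d yhat xbar i k))
    (Sum.elim
      ((matSqrt (Q.covReg d yhat xbar i k)).mulVec (Q.hvec d yhat xbar i k))
      (-((matSqrt (Q.covReg d yhat xbar i k)).mulVec (Q.hvec d yhat xbar i k))))

/-- Feasible points `(x, u, s)` of the program of iteration `w`, linearized at `xbar`, with trust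
region `χ τ ^ w`. -/
structure SCPFeasible [NeZero Nh] (χ τ : ℝ) (w : ℕ)
    (x : Fin Nh → Vec nx) (u : Fin Nh → Vec nu) (s : Fin Nh → Fin Nobs → Fin 3 → ℝ) :
    Prop where
  admissible : Q.Admissible x u
  collision : ∀ i k,
    (Q.Lam d yhat xbar i k).mulVec (Sum.elim (x i) (s i k)) ≤ Q.Gam d yhat xbar i k
  trust : ∀ i, ‖x i - xbar i‖ ≤ χ * τ ^ w

/-- Solutions (minimizers) of the program of iteration `w`. -/
structure IsSCPSolution [NeZero Nh] (χ τ : ℝ) (w : ℕ)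
    (x : Fin Nh → Vec nx) (u : Fin Nh → Vec nu) (s : Fin Nh → Fin Nobs → Fin 3 → ℝ) :
    Prop where
  feasible : Q.SCPFeasible d yhat xbar χ τ w x u s
  optimal : ∀ x' u' s', Q.SCPFeasible d yhat xbar χ τ w x' u' s' →
    Q.totalCost x u ≤ Q.totalCost x' u'

/-- The laws of the predicted obstacle centres that are compatible with the sample moments along a
sequence `xs` of iterates: the linearized constraint function of every iteration has the mean, and
at most the variance, of its bootstrap sample. In addition almost surely no predicted
centre is the position of the initial guess, where the first linearization degenerates. -/
structure Compatible (xs : ℕ → Fin Nh → Vec nx) (P : Measure (Centers Nh Nobs)) : Prop where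
  isProbabilityMeasure : IsProbabilityMeasure P
  ae_ne : ∀ i k, ∀ᵐ Y ∂P, Y i k ≠ Q.pos (xs 0 i)
  memLp : ∀ w i k, MemLp (fun Y => Q.zfun k (xs w i) (xs (w + 1) i) (Y i k)) 2 P
  mean_eq : ∀ w i k, ∫ Y, Q.zfun k (xs w i) (xs (w + 1) i) (Y i k) ∂P =
    sampleMean fun j => Q.zfun k (xs w i) (xs (w + 1) i) (yhat j i k)
  variance_le : ∀ w i k, variance (fun Y => Q.zfun k (xs w i) (xs (w + 1) i) (Y i k)) P ≤
    sampleCov d (fun j => Q.zfun k (xs w i) (xs (w + 1) i) (yhat j i k))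
      fun j => Q.zfun k (xs w i) (xs (w + 1) i) (yhat j i k)

end PlanningProblem

end SSAMPC

end

/-!
For a point `x` of the program linearized at `x̄`, write `p = C x` and let `R` be the regularized
covariance matrix `Σ̃`. The two lower blocks of the collision constraint say that `s` dominates
`|R^{1/2} (p - h)|` componentwise. Completing the square (`quadratic_eq_sub_inv`) turns
`‖R^{1/2} (p - h)‖² + κ` into `pᵀ R p + 2 pᵀ Σ_αβ + Σ_β`, which is at least the sample variance of
the linearized constraint function `z`, as `R - Σ_α` is a projection
(`PlanningProblem.sampleCov_zfun_le`). Hence the first row says that the sample mean of `z` plus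
`ν` sample standard deviations is at most `0`
(`PlanningProblem.sampleMean_add_sqrt_sampleCov_nonpos`).

For a compatible law, Cantelli's inequality then gives `P (z ≥ 0) ≤ ε / N_obs`, except if `z = 0`
almost surely (`measure_nonneg_le_or_ae_eq_zero`). A collision forces `z > 0` unless the centre of
the obstacle is `C x̄`, and in that case `z = 0`; so outside the exceptional case the chance
constraint of each obstacle follows. In the exceptional case a collision almost surely means that
the centre is `C x̄`. That event is null for the initial guess, and for later iterates it is part of
the collision event of the previous iterate; so the bound follows by induction
(`PlanningProblem.measure_collision_le`). Boole's inequality sums over the obstacles.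

The trust regions shrink geometrically, so the trajectories converge. The unsafe sets are open, so
the event that the limit is unsafe lies in the lower limit of the events that the iterates are
unsafe, and continuity from below bounds its probability
(`PlanningProblem.measure_unsafe_le_of_tendsto`). The other constraints are closed.
-/

namespace SSAMPC

/-! ### The regularized covariance matrix and its square root -/

theorem continuousOn_spectrum (M : Matrix (Fin 3) (Fin 3) ℝ) (f : ℝ → ℝ) :
    ContinuousOn f (spectrum ℝ M) :=
  Set.Finite.continuousOn (Matrix.finite_spectrum M) f

theorem isHermitian_cfc (f : ℝ → ℝ) (M : Matrix (Fin 3) (Fin 3) ℝ) : (cfc f M).IsHermitian :=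
  cfc_predicate f M

/-- If `f = g²` on the spectrum of `M`, then `f(M) = g(M)ᵀ g(M)` is positive semidefinite. -/
theorem posSemidef_cfc_of_mul_self {M : Matrix (Fin 3) (Fin 3) ℝ} {f g : ℝ → ℝ}
    (h : ∀ t ∈ spectrum ℝ M, f t = g t * g t) : (cfc f M).PosSemidef := by
  have e : cfc f M = (cfc g M).conjTranspose * cfc g M := by
    rw [(isHermitian_cfc g M).eq, ← cfc_mul g g M (continuousOn_spectrum M g)
      (continuousOn_spectrum M g)]
    exact cfc_congr h
  rw [e]
  exact Matrix.posSemidef_conjTranspose_mul_self _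

theorem posSemidef_nullProj (M : Matrix (Fin 3) (Fin 3) ℝ) : (nullProj M).PosSemidef :=
  posSemidef_cfc_of_mul_self (g := fun t => if t = 0 then 1 else 0) (by intro t _; simp)

theorem spectrum_nonneg {M : Matrix (Fin 3) (Fin 3) ℝ} (hM : M.PosSemidef) :
    ∀ t ∈ spectrum ℝ M, 0 ≤ t :=
  fun _ ht => (Matrix.posSemidef_iff_isHermitian_and_spectrum_nonneg.1 hM).2 ht

theorem posSemidef_regularized {M : Matrix (Fin 3) (Fin 3) ℝ} (hM : M.PosSemidef) :
    (regularized M).PosSemidef :=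
  hM.add (posSemidef_nullProj M)

/-- On the spectrum, the regularization is `t ↦ t + 𝟙[t = 0]`, which has no zeros. -/
theorem isUnit_regularized {M : Matrix (Fin 3) (Fin 3) ℝ} (hM : M.IsHermitian) :
    IsUnit (regularized M) := by
  have e : regularized M = cfc (fun t : ℝ => t + if t = 0 then 1 else 0) M := by
    rw [cfc_add (a := M) _ _ (continuousOn_spectrum M _) (continuousOn_spectrum M _),
      cfc_id' ℝ M hM.isSelfAdjoint]
    rfl
  rw [e, isUnit_cfc_iff _ M (continuousOn_spectrum M _) hM.isSelfAdjoint]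
  intro t _
  by_cases h : t = 0 <;> simp [h]

theorem matSqrt_mul_self {M : Matrix (Fin 3) (Fin 3) ℝ} (hM : M.PosSemidef) :
    matSqrt M * matSqrt M = M := by
  unfold matSqrt
  rw [← cfc_mul _ _ M (continuousOn_spectrum M _) (continuousOn_spectrum M _)]
  conv_rhs => rw [← cfc_id' ℝ M hM.isHermitian.isSelfAdjoint]
  exact cfc_congr fun t ht => Real.mul_self_sqrt (spectrum_nonneg hM t ht)

theorem dotProduct_matSqrt {M : Matrix (Fin 3) (Fin 3) ℝ} (hM : M.PosSemidef) (v : Fin 3 → ℝ) :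
    (matSqrt M).mulVec v ⬝ᵥ (matSqrt M).mulVec v = v ⬝ᵥ M.mulVec v := by
  have hS : (matSqrt M).transpose = matSqrt M := by
    simpa [matSqrt] using (isHermitian_cfc Real.sqrt M).eq
  conv_rhs => rw [← matSqrt_mul_self hM, ← Matrix.mulVec_mulVec, Matrix.dotProduct_mulVec,
    ← Matrix.mulVec_transpose, hS]

/-- Completion of the square: with `h = -R⁻¹ c`, the quadratic polynomial `v ↦ vᵀ R v + 2 vᵀ c` is
`(v - h)ᵀ R (v - h) - cᵀ R⁻¹ c`. -/
theorem quadratic_eq_sub_inv {R : Matrix (Fin 3) (Fin 3) ℝ} (hR : R.IsHermitian) (hu : IsUnit R)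
    (c v : Fin 3 → ℝ) :
    v ⬝ᵥ R.mulVec v + 2 * (v ⬝ᵥ c) =
      (v - -(R⁻¹.mulVec c)) ⬝ᵥ R.mulVec (v - -(R⁻¹.mulVec c)) - c ⬝ᵥ R⁻¹.mulVec c := by
  have hc : R.mulVec (R⁻¹.mulVec c) = c := by
    rw [Matrix.mulVec_mulVec, Matrix.mul_nonsing_inv R ((Matrix.isUnit_iff_isUnit_det R).1 hu),
      Matrix.one_mulVec]
  have hT : R.transpose = R := by simpa using hR.eq
  have h1 : R⁻¹.mulVec c ⬝ᵥ R.mulVec v = v ⬝ᵥ c := by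
    rw [Matrix.dotProduct_mulVec, ← Matrix.mulVec_transpose, hT, hc, dotProduct_comm]
  rw [sub_neg_eq_add, Matrix.mulVec_add, hc, add_dotProduct, dotProduct_add, dotProduct_add, h1,
    dotProduct_comm (R⁻¹.mulVec c) c]
  ring

/-! ### Sample moments -/

theorem sampleMean_add {N : ℕ} (a b : Fin N → ℝ) :
    sampleMean (fun j => a j + b j) = sampleMean a + sampleMean b := by
  simp [sampleMean, Finset.sum_add_distrib, add_div]

theorem sampleMean_mul_const {N : ℕ} (a : Fin N → ℝ) (c : ℝ) :
    sampleMean (fun j => a j * c) = sampleMean a * c := by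
  simp [sampleMean, ← Finset.sum_mul, div_mul_eq_mul_div]

theorem sampleMean_dotProduct {N : ℕ} (f : Fin N → Fin 3 → ℝ) (g : Fin N → ℝ) (p : Fin 3 → ℝ) :
    sampleMean (fun j => f j ⬝ᵥ p + g j) =
      (fun a => sampleMean fun j => f j a) ⬝ᵥ p + sampleMean g := by
  simp only [dotProduct, Fin.sum_univ_three, sampleMean_add, sampleMean_mul_const]

/-- The sample variance of `fᵀ p + g`, for sampled coefficients `f` and offsets `g`. -/
theorem sampleCov_dotProduct {N : ℕ} (d : ℕ) (f : Fin N → Fin 3 → ℝ) (g : Fin N → ℝ)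
    (p : Fin 3 → ℝ) :
    sampleCov d (fun j => f j ⬝ᵥ p + g j) (fun j => f j ⬝ᵥ p + g j) =
      p ⬝ᵥ (Matrix.of fun a b => sampleCov d (fun j => f j a) fun j => f j b).mulVec p +
        2 * (p ⬝ᵥ fun a => sampleCov d (fun j => f j a) g) + sampleCov d g g := by
  unfold sampleCov
  rw [sampleMean_dotProduct]
  simp only [dotProduct, Matrix.mulVec, Matrix.of_apply, Fin.sum_univ_three, Finset.mul_sum,
    Finset.sum_div, ← Finset.sum_add_distrib, Finset.sum_mul]
  refine Finset.sum_congr rfl fun j _ => ?_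
  ring

theorem sampleCov_self_nonneg {N : ℕ} (d : ℕ) (a : Fin N → ℝ) : 0 ≤ sampleCov d a a :=
  div_nonneg (Finset.sum_nonneg fun _ _ => mul_self_nonneg _) d.cast_nonneg

theorem posSemidef_sampleCov {N : ℕ} (d : ℕ) (f : Fin N → Fin 3 → ℝ) :
    (Matrix.of fun a b => sampleCov d (fun j => f j a) fun j => f j b).PosSemidef := by
  refine Matrix.PosSemidef.of_dotProduct_mulVec_nonneg ?_ fun p => ?_
  · ext a b
    simp [sampleCov, mul_comm]
  · have h := sampleCov_dotProduct d f (fun _ => 0) p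
    have h0 := sampleCov_self_nonneg d fun j => f j ⬝ᵥ p + 0
    have e : ∀ a : Fin N → ℝ, sampleCov d a (fun _ => 0) = 0 := by
      intro a; simp [sampleCov, sampleMean]
    rw [h] at h0
    simpa [e, dotProduct] using h0

/-! ### The one-sided Chebyshev inequality -/

/-- Cantelli's inequality, from Markov's inequality for `(X - 𝔼 X + v / t) ^ 2`. -/
theorem measureReal_ge_le_variance_div_add_sq {Ω : Type*} [MeasurableSpace Ω] {P : Measure Ω}
    [IsProbabilityMeasure P] {X : Ω → ℝ} (hX : MemLp X 2 P) {t : ℝ} (ht : 0 < t) :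
    P.real {ω | t ≤ X ω - ∫ ω', X ω' ∂P} ≤ variance X P / (variance X P + t ^ 2) := by
  set m := ∫ ω', X ω' ∂P
  set v := variance X P with hv
  have hv0 : 0 ≤ v := variance_nonneg X P
  -- the shift that optimizes the resulting bound
  set c := v / t with hc
  have hc0 : 0 ≤ c := by positivity
  have hX1 : Integrable X P := hX.integrable (by norm_num)
  have hXm : MemLp (fun ω => X ω - m) 2 P := hX.sub (memLp_const m)
  have hi1 : Integrable (fun ω => X ω - m) P := hXm.integrable (by norm_num)
  have hi2 : Integrable (fun ω => (X ω - m) ^ 2) P := hXm.integrable_sq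
  have hint : ∫ ω, (X ω - m + c) ^ 2 ∂P = v + c ^ 2 := by
    have e : (fun ω => (X ω - m + c) ^ 2) =
        fun ω => (X ω - m) ^ 2 + (2 * c * (X ω - m) + c ^ 2) := by
      ext ω; ring
    have h0 : ∫ ω, (X ω - m) ∂P = 0 := by
      rw [integral_sub hX1 (integrable_const m)]; simp [m]
    have hlin : Integrable (fun ω => 2 * c * (X ω - m) + c ^ 2) P :=
      (hi1.const_mul _).add (integrable_const _)
    rw [e, integral_add hi2 hlin,
      integral_add (hi1.const_mul _) (integrable_const _), integral_const_mul, h0,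
      ← variance_eq_integral hX.1.aemeasurable]
    simp [hv]
  have hi : Integrable (fun ω => (X ω - m + c) ^ 2) P :=
    (hXm.add (memLp_const c)).integrable_sq
  have hmk := mul_meas_ge_le_integral_of_nonneg (μ := P)
    (f := fun ω => (X ω - m + c) ^ 2) (ae_of_all _ fun ω => sq_nonneg _) hi ((t + c) ^ 2)
  rw [hint] at hmk
  have hsub : P.real {ω | t ≤ X ω - m} ≤ P.real {ω | (t + c) ^ 2 ≤ (X ω - m + c) ^ 2} := by
    refine measureReal_mono fun ω hω => ?_
    have hω' : t ≤ X ω - m := hω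
    exact pow_le_pow_left₀ (add_nonneg ht.le hc0) (add_le_add_left hω' c) 2
  have htc : 0 < (t + c) ^ 2 := by positivity
  calc P.real {ω | t ≤ X ω - m} ≤ (v + c ^ 2) / (t + c) ^ 2 := by
        rw [le_div_iff₀ htc, mul_comm]
        exact (mul_le_mul_of_nonneg_left hsub htc.le).trans hmk
    _ = v / (v + t ^ 2) := by
        have : 0 < v + t ^ 2 := by positivity
        rw [hc]
        field_simp
        ring

/-- If `𝔼 X + ν σ ≤ 0`, where `σ` bounds the standard deviation, `ν = √((1 - e) / e)` and
`0 < e ≤ 1`, then `X` is nonnegative with probability at most `e`, or `X = 0` almost surely. -/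
theorem measure_nonneg_le_or_ae_eq_zero {Ω : Type*} [MeasurableSpace Ω] {P : Measure Ω}
    [IsProbabilityMeasure P] {X : Ω → ℝ} (hX : MemLp X 2 P) {e σ : ℝ} (he : 0 < e) (he1 : e ≤ 1)
    (hσ : 0 ≤ σ) (hvar : variance X P ≤ σ ^ 2)
    (hmean : ∫ ω, X ω ∂P + Real.sqrt ((1 - e) / e) * σ ≤ 0) :
    P {ω | 0 ≤ X ω} ≤ ENNReal.ofReal e ∨ ∀ᵐ ω ∂P, X ω = 0 := by
  set n := Real.sqrt ((1 - e) / e)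
  have hn0 : 0 ≤ n := Real.sqrt_nonneg _
  have hn2 : n ^ 2 = (1 - e) / e := Real.sq_sqrt (div_nonneg (by linarith) he.le)
  have hen : e * (1 + n ^ 2) = 1 := by rw [hn2]; field_simp; ring
  have hnσ : 0 ≤ n * σ := by positivity
  set m := ∫ ω, X ω ∂P with hm
  have hv0 : 0 ≤ variance X P := variance_nonneg X P
  rcases eq_or_lt_of_le (show m ≤ 0 by linarith) with h0 | hneg
  -- for mean `0` either `ν = 0`, so that `e = 1`, or the variance is `0`
  · rcases mul_eq_zero.1 (show n * σ = 0 by linarith) with h | h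
    · left
      have : e = 1 := by simpa [h] using hen
      rw [this, ENNReal.ofReal_one]
      exact prob_le_one
    · right
      have hv : variance X P = 0 := le_antisymm (by simpa [h] using hvar) hv0
      have := (evariance_eq_zero_iff hX.1.aemeasurable).1
        (by rw [← hX.ofReal_variance_eq, hv, ENNReal.ofReal_zero])
      filter_upwards [this] with ω hω
      rw [hω]
      exact h0
  · left
    have hC := measureReal_ge_le_variance_div_add_sq hX (neg_pos.2 hneg)
    have hset : {ω | -m ≤ X ω - ∫ ω', X ω' ∂P} = {ω | 0 ≤ X ω} := by
      ext ω
      simp only [Set.mem_ofPred_eq, ← hm]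
      constructor <;> intro h <;> linarith
    rw [hset] at hC
    have hle : variance X P / (variance X P + (-m) ^ 2) ≤ e := by
      have hpos : 0 < variance X P + (-m) ^ 2 := by nlinarith [sq_pos_of_neg hneg]
      rw [div_le_iff₀ hpos]
      have h1 : n ^ 2 * variance X P ≤ (-m) ^ 2 :=
        calc n ^ 2 * variance X P ≤ n ^ 2 * σ ^ 2 := by gcongr
          _ = (n * σ) ^ 2 := by ring
          _ ≤ (-m) ^ 2 := pow_le_pow_left₀ hnσ (by linarith) 2
      calc variance X P = e * (variance X P + n ^ 2 * variance X P) := by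
            linear_combination -variance X P * hen
        _ ≤ e * (variance X P + (-m) ^ 2) := by gcongr
    rw [← ofReal_measureReal]
    exact ENNReal.ofReal_le_ofReal (hC.trans hle)

/-! ### The bootstrap distribution -/

theorem isProbabilityMeasure_bootstrapLaw {N Nh Nobs : ℕ} (hN : 0 < N)
    (yhat : Fin N → Centers Nh Nobs) : IsProbabilityMeasure (bootstrapLaw yhat) := by
  constructor
  simp only [bootstrapLaw, Measure.smul_apply, Measure.finsetSum_apply, measure_univ,
    Finset.sum_const, Finset.card_univ, Fintype.card_fin, nsmul_eq_mul, mul_one, smul_eq_mul]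
  exact ENNReal.inv_mul_cancel (by exact_mod_cast hN.ne') (ENNReal.natCast_ne_top N)

theorem ae_bootstrapLaw {N Nh Nobs : ℕ} (yhat : Fin N → Centers Nh Nobs)
    {p : Centers Nh Nobs → Prop} (h : ∀ j, p (yhat j)) : ∀ᵐ Y ∂bootstrapLaw yhat, p Y := by
  refine Measure.ae_smul_measure ?_ _
  rw [ae_iff, Measure.finsetSum_apply]
  refine Finset.sum_eq_zero fun j _ => ?_
  rw [← ae_iff, ae_dirac_eq]
  exact h j

theorem integrable_bootstrapLaw {N Nh Nobs : ℕ} (hN : 0 < N) (yhat : Fin N → Centers Nh Nobs)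
    (f : Centers Nh Nobs → ℝ) : Integrable f (bootstrapLaw yhat) := by
  refine Integrable.smul_measure ?_ (by simp [hN.ne'])
  exact integrable_finsetSum_measure.2 fun j _ => integrable_dirac (by simp)

theorem integral_bootstrapLaw {N Nh Nobs : ℕ} (yhat : Fin N → Centers Nh Nobs)
    (f : Centers Nh Nobs → ℝ) : ∫ Y, f Y ∂bootstrapLaw yhat = sampleMean fun j => f (yhat j) := by
  rw [bootstrapLaw, integral_smul_measure,
    integral_finsetSum_measure fun j _ => integrable_dirac (by simp)]
  simp [sampleMean, div_eq_inv_mul]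

theorem memLp_bootstrapLaw {N Nh Nobs : ℕ} (hN : 0 < N) (yhat : Fin N → Centers Nh Nobs)
    (f : Centers Nh Nobs → ℝ) : MemLp f 2 (bootstrapLaw yhat) :=
  (memLp_two_iff_integrable_sq (integrable_bootstrapLaw hN yhat f).1).2
    (integrable_bootstrapLaw hN yhat _)

theorem variance_bootstrapLaw_le {N Nh Nobs d : ℕ} (hd : 0 < d) (hdN : d ≤ N)
    (yhat : Fin N → Centers Nh Nobs) (f : Centers Nh Nobs → ℝ) :
    variance f (bootstrapLaw yhat) ≤
      sampleCov d (fun j => f (yhat j)) fun j => f (yhat j) := by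
  rw [variance_eq_integral (integrable_bootstrapLaw (hd.trans_le hdN) yhat f).1.aemeasurable,
    integral_bootstrapLaw, integral_bootstrapLaw]
  simp only [sampleCov, pow_two]
  rw [sampleMean]
  have : (0 : ℝ) < d := by exact_mod_cast hd
  exact div_le_div_of_nonneg_left (Finset.sum_nonneg fun _ _ => mul_self_nonneg _) this
    (by exact_mod_cast hdN)

namespace PlanningProblem

variable {nx nu ny Nh Nobs N : ℕ} (Q : PlanningProblem nx nu ny Nh Nobs)

/-! ### Geometry of the linearized collision constraint -/

theorem pos_apply (x : Vec nx) : (Q.pos x : Fin 3 → ℝ) = Q.C.mulVec x := rfl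

theorem continuous_pos : Continuous Q.pos :=
  (Matrix.toEuclideanLin Q.C).continuous_of_finiteDimensional

theorem rbar_pos (k : Fin Nobs) : 0 < Q.rbar k := by
  have := Q.radius_pos k
  have := Q.radius_le_radiusEst k
  have := Q.safetyRadius_nonneg
  unfold rbar
  linarith

theorem zfun_eq_dotProduct (k : Fin Nobs) (xbar x : Vec nx) (y : Vec 3) :
    Q.zfun k xbar x y = (Q.alpha xbar y : Fin 3 → ℝ) ⬝ᵥ Q.C.mulVec x + Q.beta k xbar y := by
  rw [zfun, ← pos_apply, EuclideanSpace.inner_eq_star_dotProduct, dotProduct_comm]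
  simp

theorem zfun_eq_inner (k : Fin Nobs) (xbar x : Vec nx) (y : Vec 3) :
    Q.zfun k xbar x y = Q.rbar k * ‖Q.pos xbar - y‖ -
      inner ℝ (Q.pos xbar - y) (Q.pos x - y) := by
  rw [zfun, alpha, beta, inner_neg_left, inner_sub_right (Q.pos xbar - y) (Q.pos x) y,
    real_inner_comm (Q.pos xbar - y) y]
  ring

theorem zfun_eq_zero (k : Fin Nobs) {xbar : Vec nx} (x : Vec nx) {y : Vec 3}
    (h : y = Q.pos xbar) : Q.zfun k xbar x y = 0 := by
  rw [zfun_eq_inner, h]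
  simp

/-- A collision violates the linearized constraint, unless the constraint is linearized at the
centre of the obstacle. -/
theorem zfun_pos_of_mem_ball (k : Fin Nobs) {xbar x : Vec nx} {y : Vec 3} (hy : y ≠ Q.pos xbar)
    (h : Q.pos x ∈ Metric.ball y (Q.rbar k)) : 0 < Q.zfun k xbar x y := by
  rw [Metric.mem_ball, dist_eq_norm] at h
  have h0 : 0 < ‖Q.pos xbar - y‖ := norm_pos_iff.2 (sub_ne_zero.2 hy.symm)
  have h1 := real_inner_le_norm (Q.pos xbar - y) (Q.pos x - y)
  rw [zfun_eq_inner]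
  nlinarith [mul_lt_mul_of_pos_left h h0]

/-! ### From the affine constraints to the sample moments -/

variable (d : ℕ) (yhat : Fin N → Centers Nh Nobs)

theorem collision_rows (xbar : Fin Nh → Vec nx) (i : Fin Nh) (k : Fin Nobs) {x : Vec nx}
    {s : Fin 3 → ℝ}
    (h : (Q.Lam d yhat xbar i k).mulVec (Sum.elim x s) ≤ Q.Gam d yhat xbar i k) :
    Q.meanAlpha yhat xbar i k ⬝ᵥ Q.C.mulVec x + Q.ν * ∑ a, s a ≤
        -Q.meanBeta yhat xbar i k - Q.ν * Real.sqrt (3 * Q.kres d yhat xbar i k) ∧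
      ∀ a, |(matSqrt (Q.covReg d yhat xbar i k)).mulVec
        (Q.C.mulVec x - Q.hvec d yhat xbar i k) a| ≤ s a := by
  unfold Lam Gam at h
  rw [Matrix.fromRows_mulVec, Matrix.fromRows_mulVec, Matrix.fromCols_mulVec_sumElim,
    Matrix.fromCols_mulVec_sumElim, Matrix.fromCols_mulVec_sumElim] at h
  constructor
  · have h1 := h (Sum.inl 0)
    simp only [Sum.elim_inl, Pi.add_apply] at h1
    refine le_trans (le_of_eq ?_) h1
    congr 1
    · exact Matrix.dotProduct_mulVec _ _ _
    · simp [Matrix.mulVec, dotProduct, Finset.mul_sum]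
  · intro a
    have h1 := h (Sum.inr (Sum.inl a))
    have h2 := h (Sum.inr (Sum.inr a))
    simp only [Sum.elim_inl, Sum.elim_inr, Pi.add_apply, Matrix.neg_mulVec, Matrix.one_mulVec,
      ← Matrix.mulVec_mulVec, Pi.neg_apply] at h1 h2
    rw [Matrix.mulVec_sub, Pi.sub_apply, abs_le]
    constructor <;> linarith

theorem sampleMean_zfun (xbar : Fin Nh → Vec nx) (i : Fin Nh) (k : Fin Nobs) (x : Vec nx) :
    sampleMean (fun j => Q.zfun k (xbar i) x (yhat j i k)) =
      Q.meanAlpha yhat xbar i k ⬝ᵥ Q.C.mulVec x + Q.meanBeta yhat xbar i k := by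
  simp only [zfun_eq_dotProduct]
  exact sampleMean_dotProduct _ _ _

/-- The squared norm of `Σ̃^{1/2} (C x - h)` plus the residual `κ` exceeds the sample variance of the
linearized constraint function by the contribution of the projection onto the kernel, which is
nonnegative. No sign of `κ` is needed. -/
theorem sampleCov_zfun_le (xbar : Fin Nh → Vec nx) (i : Fin Nh) (k : Fin Nobs) (x : Vec nx) :
    sampleCov d (fun j => Q.zfun k (xbar i) x (yhat j i k))
        (fun j => Q.zfun k (xbar i) x (yhat j i k)) ≤
      (matSqrt (Q.covReg d yhat xbar i k)).mulVec (Q.C.mulVec x - Q.hvec d yhat xbar i k) ⬝ᵥ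
        (matSqrt (Q.covReg d yhat xbar i k)).mulVec (Q.C.mulVec x - Q.hvec d yhat xbar i k) +
      Q.kres d yhat xbar i k := by
  have hM : (Q.covAlpha d yhat xbar i k).PosSemidef := posSemidef_sampleCov d _
  have hR := posSemidef_regularized hM
  set p := Q.C.mulVec x
  have hvar : sampleCov d (fun j => Q.zfun k (xbar i) x (yhat j i k))
        (fun j => Q.zfun k (xbar i) x (yhat j i k)) =
      p ⬝ᵥ (Q.covAlpha d yhat xbar i k).mulVec p + 2 * (p ⬝ᵥ Q.covAlphaBeta d yhat xbar i k) +
        Q.varBeta d yhat xbar i k := by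
    simp only [zfun_eq_dotProduct]
    exact sampleCov_dotProduct d _ _ p
  have hle : p ⬝ᵥ (Q.covAlpha d yhat xbar i k).mulVec p ≤
      p ⬝ᵥ (Q.covReg d yhat xbar i k).mulVec p := by
    have h0 := (posSemidef_nullProj (Q.covAlpha d yhat xbar i k)).dotProduct_mulVec_nonneg p
    rw [star_trivial] at h0
    rw [covReg, regularized, Matrix.add_mulVec, dotProduct_add]
    linarith
  have hsq := quadratic_eq_sub_inv hR.isHermitian (isUnit_regularized hM.isHermitian)
    (Q.covAlphaBeta d yhat xbar i k) p
  have hroot := dotProduct_matSqrt hR (p - Q.hvec d yhat xbar i k)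
  rw [hvar, covReg, hroot]
  rw [covReg] at hle
  simp only [hvec, kres, covReg] at hsq ⊢
  linarith

/-- The affine constraints put the sample mean of the linearized constraint function at least `ν`
sample standard deviations below zero, because an `ℓ¹` norm bounds an `ℓ²` norm. -/
theorem sampleMean_add_sqrt_sampleCov_nonpos (xbar : Fin Nh → Vec nx) (i : Fin Nh) (k : Fin Nobs)
    {x : Vec nx} {s : Fin 3 → ℝ}
    (h : (Q.Lam d yhat xbar i k).mulVec (Sum.elim x s) ≤ Q.Gam d yhat xbar i k) :
    sampleMean (fun j => Q.zfun k (xbar i) x (yhat j i k)) +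
      Q.ν * Real.sqrt (sampleCov d (fun j => Q.zfun k (xbar i) x (yhat j i k))
        fun j => Q.zfun k (xbar i) x (yhat j i k)) ≤ 0 := by
  obtain ⟨h1, h2⟩ := Q.collision_rows d yhat xbar i k h
  have hcov := Q.sampleCov_zfun_le d yhat xbar i k x
  set q := (matSqrt (Q.covReg d yhat xbar i k)).mulVec (Q.C.mulVec x - Q.hvec d yhat xbar i k)
  set κ := Q.kres d yhat xbar i k
  have hs : ∀ a, 0 ≤ s a := fun a => (abs_nonneg _).trans (h2 a)
  have hq : q ⬝ᵥ q ≤ (∑ a, s a) ^ 2 := by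
    have h3 : ∀ a, q a * q a ≤ s a * s a := fun a => by
      rw [← abs_mul_abs_self]
      exact mul_self_le_mul_self (abs_nonneg _) (h2 a)
    have := h3 0
    have := h3 1
    have := h3 2
    have := mul_nonneg (hs 0) (hs 1)
    have := mul_nonneg (hs 0) (hs 2)
    have := mul_nonneg (hs 1) (hs 2)
    simp only [dotProduct, Fin.sum_univ_three]
    nlinarith
  -- for negative `κ` the square root is `0`, and the bound still holds
  have hκ : κ ≤ Real.sqrt (3 * κ) ^ 2 := by
    rcases le_total 0 κ with h0 | h0
    · rw [Real.sq_sqrt (by positivity)]; linarith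
    · exact h0.trans (sq_nonneg _)
  have hS : 0 ≤ ∑ a, s a := Finset.sum_nonneg fun a _ => hs a
  have hsqrt : Real.sqrt (sampleCov d (fun j => Q.zfun k (xbar i) x (yhat j i k))
      fun j => Q.zfun k (xbar i) x (yhat j i k)) ≤ ∑ a, s a + Real.sqrt (3 * κ) := by
    refine Real.sqrt_le_iff.2 ⟨by positivity, ?_⟩
    nlinarith [mul_nonneg hS (Real.sqrt_nonneg (3 * κ))]
  have hν : 0 ≤ Q.ν := Real.sqrt_nonneg _
  rw [sampleMean_zfun]
  have := mul_le_mul_of_nonneg_left hsqrt hν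
  linarith

/-! ### The chance constraints along the iterates -/

theorem εn_pos (k : Fin Nobs) : 0 < Q.εn :=
  div_pos Q.ε_pos (by exact_mod_cast k.pos)

theorem εn_le_one (k : Fin Nobs) : Q.εn ≤ 1 :=
  div_le_one_of_le₀ (Q.ε_le_one.trans (by exact_mod_cast k.pos)) (Nat.cast_nonneg _)

variable {d yhat}

/-- By induction, the probability to collide with obstacle `k` is at most `ε / N_obs`. Cantelli's
inequality bounds the probability that the linearized constraint function is nonnegative, which
includes the event that the centre is the point of linearization. Its degenerate case, where the
constraint function vanishes almost surely, leaves that event alone, which is part of the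
collision event of the previous iterate. -/
theorem measure_collision_le [NeZero Nh] {χ τ : ℝ} {xs : ℕ → Fin Nh → Vec nx}
    {us : ℕ → Fin Nh → Vec nu} {ss : ℕ → Fin Nh → Fin Nobs → Fin 3 → ℝ}
    (hf : ∀ w, Q.SCPFeasible d yhat (xs w) χ τ (w + 1) (xs (w + 1)) (us (w + 1)) (ss (w + 1)))
    {P : Measure (Centers Nh Nobs)} (hP : Q.Compatible d yhat xs P) (i : Fin Nh) (k : Fin Nobs)
    (w : ℕ) :
    P {Y | Q.pos (xs (w + 1) i) ∈ Metric.ball (Y i k) (Q.rbar k)} ≤ ENNReal.ofReal Q.εn := by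
  have := hP.isProbabilityMeasure
  have step : ∀ w, P {Y | Y i k = Q.pos (xs w i)} ≤ ENNReal.ofReal Q.εn →
      P {Y | Q.pos (xs (w + 1) i) ∈ Metric.ball (Y i k) (Q.rbar k)} ≤ ENNReal.ofReal Q.εn := by
    intro w hw
    have hmoment := Q.sampleMean_add_sqrt_sampleCov_nonpos d yhat (xs w) i k
      ((hf w).collision i k)
    have hvar := hP.variance_le w i k
    rw [← Real.sq_sqrt (sampleCov_self_nonneg d _)] at hvar
    rw [← hP.mean_eq w i k] at hmoment
    rcases measure_nonneg_le_or_ae_eq_zero (hP.memLp w i k) (Q.εn_pos k) (Q.εn_le_one k)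
      (Real.sqrt_nonneg _) hvar hmoment with h | h
    · refine (measure_mono fun Y hY => ?_).trans h
      by_cases hc : Y i k = Q.pos (xs w i)
      · exact (Q.zfun_eq_zero k _ hc).ge
      · exact (Q.zfun_pos_of_mem_ball k hc hY).le
    · refine (measure_mono_ae ?_).trans hw
      filter_upwards [h] with Y hz hY
      by_contra hc
      exact (Q.zfun_pos_of_mem_ball k hc hY).ne' hz
  induction w with
  | zero =>
    refine step 0 ?_
    have : P {Y | Y i k = Q.pos (xs 0 i)} = 0 := by
      simpa [ae_iff] using hP.ae_ne i k
    rw [this]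
    exact zero_le
  | succ w ih =>
    refine step (w + 1) ((measure_mono fun Y hY => ?_).trans ih)
    have hY' : Y i k = Q.pos (xs (w + 1) i) := hY
    rw [Set.mem_ofPred_eq, hY']
    exact Metric.mem_ball_self (Q.rbar_pos k)

/-- Boole's inequality over the obstacles. -/
theorem measure_unsafe_le {P : Measure (Centers Nh Nobs)} {i : Fin Nh} {x : Vec nx}
    (h : ∀ k, P {Y | Q.pos x ∈ Metric.ball (Y i k) (Q.rbar k)} ≤ ENNReal.ofReal Q.εn) :
    P {Y | Q.pos x ∈ Q.unsafeSet Y i} ≤ ENNReal.ofReal Q.ε := by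
  have e : {Y : Centers Nh Nobs | Q.pos x ∈ Q.unsafeSet Y i} =
      ⋃ k, {Y | Q.pos x ∈ Metric.ball (Y i k) (Q.rbar k)} := by
    ext Y
    simp [unsafeSet]
  rw [e]
  refine (measure_iUnion_fintype_le P _).trans ((Finset.sum_le_sum fun k _ => h k).trans ?_)
  rcases Nat.eq_zero_or_pos Nobs with h0 | h0
  · subst h0
    simp
  · have hN : (Nobs : ℝ) ≠ 0 := by exact_mod_cast h0.ne'
    rw [Finset.sum_const, Finset.card_univ, Fintype.card_fin, nsmul_eq_mul,
      ← ENNReal.ofReal_natCast, ← ENNReal.ofReal_mul (Nat.cast_nonneg _), εn,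
      mul_div_cancel₀ _ hN]

/-! ### Passage to the limit -/

theorem isOpen_unsafeSet (Y : Centers Nh Nobs) (i : Fin Nh) : IsOpen (Q.unsafeSet Y i) :=
  isOpen_iUnion fun _ => Metric.isOpen_ball

/-- The unsafe set is open, so an outcome that is unsafe for the limit is unsafe for all but
finitely many members of the sequence: the bound passes to the limit by continuity of the measure
from below. -/
theorem measure_unsafe_le_of_tendsto {P : Measure (Centers Nh Nobs)} {i : Fin Nh}
    {x : ℕ → Vec nx} {xlim : Vec nx} (hx : Tendsto x atTop (𝓝 xlim)) {c : ENNReal}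
    (h : ∀ w, 1 ≤ w → P {Y | Q.pos (x w) ∈ Q.unsafeSet Y i} ≤ c) :
    P {Y | Q.pos xlim ∈ Q.unsafeSet Y i} ≤ c := by
  let S : ℕ → Set (Centers Nh Nobs) := fun n => {Y | ∀ w, n ≤ w → Q.pos (x w) ∈ Q.unsafeSet Y i}
  have hS : Monotone S := fun m n hmn Y hY w hw => hY w (hmn.trans hw)
  have hsub : {Y | Q.pos xlim ∈ Q.unsafeSet Y i} ⊆ ⋃ n, S n := by
    intro Y hY
    have hev : ∀ᶠ w in atTop, Q.pos (x w) ∈ Q.unsafeSet Y i :=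
      ((Q.continuous_pos.tendsto xlim).comp hx).eventually_mem
        ((Q.isOpen_unsafeSet Y i).mem_nhds hY)
    obtain ⟨n, hn⟩ := eventually_atTop.1 hev
    exact Set.mem_iUnion.2 ⟨n, hn⟩
  refine (measure_mono hsub).trans ?_
  rw [hS.measure_iUnion]
  refine iSup_le fun n => (measure_mono fun Y hY => ?_).trans (h (n + 1) (by omega))
  exact hY (n + 1) (by omega)

theorem admissible_of_tendsto [NeZero Nh] (hx : IsClosed Q.Dx) (hu : IsClosed Q.Du) {ι : Type*}
    {l : Filter ι} [l.NeBot] {x : ι → Fin Nh → Vec nx} {u : ι → Fin Nh → Vec nu}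
    {xlim : Fin Nh → Vec nx} {ulim : Fin Nh → Vec nu} (hxl : Tendsto x l (𝓝 xlim))
    (hul : Tendsto u l (𝓝 ulim)) (h : ∀ᶠ w in l, Q.Admissible (x w) (u w)) :
    Q.Admissible xlim ulim := by
  have hxi := tendsto_pi_nhds.1 hxl
  have hui := tendsto_pi_nhds.1 hul
  have hA := (Matrix.toEuclideanLin Q.A).continuous_of_finiteDimensional
  have hB := (Matrix.toEuclideanLin Q.B).continuous_of_finiteDimensional
  refine ⟨fun i j hij => ?_, ?_, fun i => ?_, fun i => ?_⟩
  · refine tendsto_nhds_unique_of_eventuallyEq (hxi j)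
      (((hA.tendsto _).comp (hxi i)).add ((hB.tendsto _).comp (hui i))) ?_
    filter_upwards [h] with w hw
    exact hw.dynamics i j hij
  · refine tendsto_nhds_unique_of_eventuallyEq (hxi 0) tendsto_const_nhds ?_
    filter_upwards [h] with w hw
    exact hw.init
  · exact hx.mem_of_tendsto (hxi i) (h.mono fun w hw => hw.state_mem i)
  · exact hu.mem_of_tendsto (hui i) (h.mono fun w hw => hw.input_mem i)

/-! ### Convexity of the programs -/

theorem convex_setOf_SCPFeasible [NeZero Nh] (d : ℕ) (yhat : Fin N → Centers Nh Nobs) (χ τ : ℝ)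
    (w : ℕ) (xbar : Fin Nh → Vec nx) :
    Convex ℝ {p : (Fin Nh → Vec nx) × (Fin Nh → Vec nu) × (Fin Nh → Fin Nobs → Fin 3 → ℝ) |
      Q.SCPFeasible d yhat xbar χ τ w p.1 p.2.1 p.2.2} := by
  rintro ⟨x, u, s⟩ hp ⟨x', u', s'⟩ hq a b ha hb hab
  simp only [Set.mem_ofPred_eq] at hp hq
  refine ⟨⟨fun i j hij => ?_, ?_, fun i => ?_, fun i => ?_⟩, fun i k => ?_, fun i => ?_⟩
  · have h1 := hp.admissible.dynamics i j hij
    have h2 := hq.admissible.dynamics i j hij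
    simp only [Prod.smul_mk, Prod.mk_add_mk, Pi.add_apply, Pi.smul_apply, h1, h2, map_add,
      map_smul]
    module
  · have h1 := hp.admissible.init
    have h2 := hq.admissible.init
    simp only [Prod.smul_mk, Prod.mk_add_mk, Pi.add_apply, Pi.smul_apply, h1, h2]
    rw [← add_smul, hab, one_smul]
  · exact Q.convex_Dx (hp.admissible.state_mem i) (hq.admissible.state_mem i) ha hb hab
  · exact Q.convex_Du (hp.admissible.input_mem i) (hq.admissible.input_mem i) ha hb hab
  · have h1 := hp.collision i k
    have h2 := hq.collision i k
    have e : (Sum.elim (((a • (x, u, s) + b • (x', u', s')).1 i : Vec nx) : Fin nx → ℝ)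
        ((a • (x, u, s) + b • (x', u', s')).2.2 i k)) =
        a • Sum.elim (x i : Fin nx → ℝ) (s i k) + b • Sum.elim (x' i : Fin nx → ℝ) (s' i k) := by
      ext (c | c) <;> simp
    rw [e, Matrix.mulVec_add, Matrix.mulVec_smul, Matrix.mulVec_smul]
    calc _ ≤ a • Q.Gam d yhat xbar i k + b • Q.Gam d yhat xbar i k :=
          add_le_add (smul_le_smul_of_nonneg_left h1 ha) (smul_le_smul_of_nonneg_left h2 hb)
      _ = Q.Gam d yhat xbar i k := by rw [← add_smul, hab, one_smul]
  · have h1 := hp.trust i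
    have h2 := hq.trust i
    rw [← dist_eq_norm, ← Metric.mem_closedBall] at h1 h2 ⊢
    exact convex_closedBall (xbar i) (χ * τ ^ w) h1 h2 ha hb hab

theorem convexOn_totalCost : ConvexOn ℝ Set.univ
    (fun p : (Fin Nh → Vec nx) × (Fin Nh → Vec nu) => Q.totalCost p.1 p.2) := by
  refine ⟨convex_univ, fun p _ q _ a b ha hb hab => ?_⟩
  simp only [totalCost, smul_eq_mul, Finset.mul_sum, ← Finset.sum_add_distrib]
  refine Finset.sum_le_sum fun i _ => ?_
  have h := (Q.convexOn_cost i).2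
    (Set.mem_univ (Q.yref i - Matrix.toEuclideanLin Q.G (p.1 i), p.2 i))
    (Set.mem_univ (Q.yref i - Matrix.toEuclideanLin Q.G (q.1 i), q.2 i)) ha hb hab
  refine le_trans (le_of_eq ?_) h
  congr 1
  refine Prod.ext ?_ rfl
  have e : Q.yref i = a • Q.yref i + b • Q.yref i := by rw [← add_smul, hab, one_smul]
  simp only [Prod.fst_add, Prod.smul_fst, Pi.add_apply, Pi.smul_apply, map_add, map_smul]
  conv_lhs => rw [e]
  module

/-! ### Convergence, and the bootstrap distribution -/

theorem compatible_bootstrapLaw {d : ℕ} (hd : 0 < d) (hdN : d ≤ N)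
    (yhat : Fin N → Centers Nh Nobs) (xs : ℕ → Fin Nh → Vec nx)
    (hguess : ∀ j i k, yhat j i k ≠ Q.pos (xs 0 i)) :
    Q.Compatible d yhat xs (bootstrapLaw yhat) where
  isProbabilityMeasure := isProbabilityMeasure_bootstrapLaw (hd.trans_le hdN) yhat
  ae_ne i k := ae_bootstrapLaw yhat fun j => hguess j i k
  memLp _ _ _ := memLp_bootstrapLaw (hd.trans_le hdN) yhat _
  mean_eq _ _ _ := integral_bootstrapLaw yhat _
  variance_le _ _ _ := variance_bootstrapLaw_le hd hdN yhat _

/-- Trust regions of geometrically decreasing radius make the trajectories a Cauchy sequence. -/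
theorem exists_tendsto_of_trust {χ τ : ℝ} (hχ : 0 ≤ χ) (hτ₀ : 0 < τ) (hτ₁ : τ < 1)
    {xs : ℕ → Fin Nh → Vec nx} (h : ∀ w i, ‖xs (w + 1) i - xs w i‖ ≤ χ * τ ^ (w + 1)) :
    ∃ xlim, Tendsto xs atTop (𝓝 xlim) := by
  refine cauchySeq_tendsto_of_complete (cauchySeq_of_le_geometric τ (χ * τ) hτ₁ fun w => ?_)
  refine (dist_pi_le_iff (by positivity)).2 fun i => ?_
  rw [dist_comm, dist_eq_norm]
  exact (h w i).trans_eq (by ring)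

end PlanningProblem
end SSAMPC

theorem theorem2 {nx nu ny Nh Nobs N d : ℕ} [NeZero Nh]
    -- sample covariances of the `N` forecasts have the divisor `N` or `N - 1`
    (hd : 0 < d) (hdN : d = N ∨ d + 1 = N)
    (Q : SSAMPC.PlanningProblem nx nu ny Nh Nobs)
    -- the bootstrap forecasts of the obstacle centres
    (yhat : Fin N → SSAMPC.Centers Nh Nobs)
    (χ τ : ℝ) (hχ : 0 ≤ χ) (hτ₀ : 0 < τ) (hτ₁ : τ < 1)
    -- the iterates; `xs 0` is the initial guess
    (xs : ℕ → Fin Nh → SSAMPC.Vec nx) (us : ℕ → Fin Nh → SSAMPC.Vec nu)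
    (ss : ℕ → Fin Nh → Fin Nobs → Fin 3 → ℝ)
    (hguess : ∀ j i k, yhat j i k ≠ Q.pos (xs 0 i))
    (hsol : ∀ w : ℕ, Q.IsSCPSolution d yhat (xs w) χ τ (w + 1)
      (xs (w + 1)) (us (w + 1)) (ss (w + 1))) :
    -- every program of the sequence is convex
    (∀ (w : ℕ) (xbar : Fin Nh → SSAMPC.Vec nx),
      Convex ℝ {p : (Fin Nh → SSAMPC.Vec nx) × (Fin Nh → SSAMPC.Vec nu) ×
          (Fin Nh → Fin Nobs → Fin 3 → ℝ) |
        Q.SCPFeasible d yhat xbar χ τ w p.1 p.2.1 p.2.2}) ∧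
    ConvexOn ℝ Set.univ (fun p : (Fin Nh → SSAMPC.Vec nx) × (Fin Nh → SSAMPC.Vec nu) =>
      Q.totalCost p.1 p.2) ∧
    -- the bootstrap distribution is one of the laws considered below
    Q.Compatible d yhat xs (SSAMPC.bootstrapLaw yhat) ∧
    -- the state trajectories converge
    ∃ xlim : Fin Nh → SSAMPC.Vec nx, Tendsto xs atTop (𝓝 xlim) ∧
      ((IsClosed Q.Du ∧ Bornology.IsBounded Q.Du) → ∃ ulim, MapClusterPt ulim atTop us) ∧
      ∀ P : Measure (SSAMPC.Centers Nh Nobs), Q.Compatible d yhat xs P →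
        -- every iterate is feasible for the planning problem, and so is every limit
        (∀ w : ℕ, 1 ≤ w → Q.Feasible P (xs w) (us w)) ∧
        (IsClosed Q.Dx → IsClosed Q.Du →
          ∀ ulim, MapClusterPt ulim atTop us → Q.Feasible P xlim ulim) := by

  have hf := fun w => (hsol w).feasible
  obtain ⟨xlim, hxlim⟩ := SSAMPC.PlanningProblem.exists_tendsto_of_trust hχ hτ₀ hτ₁
    fun w i => (hf w).trust i
  have hadm : ∀ w, 1 ≤ w → Q.Admissible (xs w) (us w) := by
    intro w hw
    obtain ⟨w, rfl⟩ := Nat.exists_eq_add_of_le' hw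
    exact (hf w).admissible
  refine ⟨fun w xbar => Q.convex_setOf_SCPFeasible d yhat χ τ w xbar, Q.convexOn_totalCost,
    Q.compatible_bootstrapLaw hd (by omega) yhat xs hguess, xlim, hxlim, ?_, fun P hP => ?_⟩
  · rintro ⟨hcl, hbd⟩
    have hK : IsCompact (Set.univ.pi fun _ : Fin Nh => Q.Du) :=
      isCompact_univ_pi fun _ => Metric.isCompact_of_isClosed_isBounded hcl hbd
    obtain ⟨ulim, -, hul⟩ := hK.exists_mapClusterPt_of_frequently (f := us) (l := atTop)
      (((eventually_ge_atTop 1).mono fun w hw i _ => (hadm w hw).input_mem i).frequently)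
    exact ⟨ulim, hul⟩
  · have hsafe : ∀ w, 1 ≤ w → ∀ i,
        P {Y | Q.pos (xs w i) ∈ Q.unsafeSet Y i} ≤ ENNReal.ofReal Q.ε := by
      intro w hw i
      obtain ⟨w, rfl⟩ := Nat.exists_eq_add_of_le' hw
      exact Q.measure_unsafe_le fun k => Q.measure_collision_le hf hP i k w
    refine ⟨fun w hw => ⟨hadm w hw, hsafe w hw⟩, fun hx hu ulim hul => ⟨?_, fun i => ?_⟩⟩
    · obtain ⟨U, hU, hUu⟩ := mapClusterPt_iff_ultrafilter.1 hul
      exact Q.admissible_of_tendsto hx hu (hxlim.mono_left hU) hUu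
        (hU ((eventually_ge_atTop 1).mono hadm))
    · exact Q.measure_unsafe_le_of_tendsto (tendsto_pi_nhds.1 hxlim i) fun w hw => hsafe w hw i
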